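/- Let $d\ge 2$ be an integer and let $c,t,a_1,b_1>0$ be real. Let $V_1,V_2,\tau_1$ be independent, where $V_1,V_2$ are uniformly distributed on the unit sphere of $\mathbb R^d$ and $\tau_1$ has the (rescaled) Beta density $$\frac{\Gamma(a_1+b_1)}{\Gamma(a_1)\Gamma(b_1)}\,\frac{1}{t^{a_1+b_1-1}}\,\tau_1^{a_1-1}(t-\tau_1)^{b_1-1},\qquad 0<\tau_1<t .$$ Let $X=c\,(\tau_1V_1+(t-\tau_1)V_2)$ be the position at time $t$ of the walk which starts at the origin of $\mathbb R^d$ and performs two steps at speed $c$, in the directions $V_1,V_2$ and of durations $\tau_1$ and $t-\tau_1$. Then $X$ has a probability density with respect to Lebesgue measure on $\mathbb R^d$. It vanishes outside the ball $\{\|x\|<ct\}$, and for (almost every) $x$ with $0<\|x\|<ct$ it equals $$p_1(x,t)=\frac{1}{2^{d-2}\pi^{\frac{d+1}{2}}}\,\frac{\Gamma(\frac d2)^2}{\Gamma(\frac d2-\frac12)}\,\frac{\Gamma(a_1+b_1)}{\Gamma(a_1)\Gamma(b_1)}\,\frac{1}{t^{a_1+b_1-1}}\,\frac{(c^2t^2-\|x\|^2)^{\frac{d-3}{2}}}{\|x\|^{d-2}c^{2d-4}}\int_{\frac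 t2-\frac{\|x\|}{2c}}^{\frac t2+\frac{\|x\|}{2c}}\tau_1^{a_1-d+1}(t-\tau_1)^{b_1-d+1}\bigl[4c^2\tau_1(t-\tau_1)-c^2t^2+\|x\|^2\bigr]^{\frac{d-3}{2}}\,d\tau_1 ,$$ where the integral is finite (the integrand is Lebesgue integrable) for every $x$ with $\|x\|<ct$. -/

import Mathlib

open MeasureTheory ProbabilityTheory

noncomputable section

namespace RandomFlight

/-- The unit sphere of `ℝ^d` with its Euclidean norm. -/
abbrev UnitSphere (d : ℕ) : Type := Metric.sphere (0 : EuclideanSpace ℝ (Fin d)) 1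

/-- The uniform distribution on the unit sphere of `ℝ^d`: normalized surface measure. -/
def uniformSphere (d : ℕ) : Measure (UnitSphere d) :=
  ((volume : Measure (EuclideanSpace ℝ (Fin d))).toSphere Set.univ)⁻¹ •
    (volume : Measure (EuclideanSpace ℝ (Fin d))).toSphere

/-- The open simplex of durations `0 < τ_k < t - ∑_{j < k} τ_j`. -/
def simplex (n : ℕ) (t : ℝ) : Set (Fin n → ℝ) :=
  {τ | ∀ k, 0 < τ k ∧ τ k < t - ∑ j ∈ Finset.Iio k, τ j}

/-- The normalizing constant of the rescaled generalized Dirichlet density. -/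
def gdConst {n : ℕ} (a b : Fin n → ℝ) (t : ℝ) : ℝ :=
  1 / t ^ (∑ k, (a k + b k - 1)) *
    ∏ k, Real.Gamma (1 + ∑ j ∈ Finset.Ici k, (a j + b j - 1)) /
      (Real.Gamma (a k) * Real.Gamma (b k + ∑ j ∈ Finset.Ioi k, (a j + b j - 1)))

/-- The rescaled generalized Dirichlet density on the simplex. -/
def gdDensity {n : ℕ} (a b : Fin n → ℝ) (t : ℝ) (τ : Fin n → ℝ) : ℝ :=
  gdConst a b t *
    ∏ k, (τ k ^ (a k - 1) * (t - ∑ j ∈ Finset.Iic k, τ j) ^ (b k - 1))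

/-- The rescaled generalized Dirichlet distribution `GD(a; b)` on the simplex. -/
def gdMeasure {n : ℕ} (a b : Fin n → ℝ) (t : ℝ) : Measure (Fin n → ℝ) :=
  (volume.restrict (simplex n t)).withDensity fun τ => ENNReal.ofReal (gdDensity a b t τ)

/-- All `n + 1` step durations: `τ_1, …, τ_n` and `τ_{n+1} = t - ∑ τ_j`. -/
def durations {n : ℕ} (t : ℝ) (τ : Fin n → ℝ) : Fin (n + 1) → ℝ :=
  Fin.snoc (α := fun _ => ℝ) τ (t - ∑ j, τ j)

/-- The position at time `t`, after `n + 1` steps at speed `c` in the directions `V_k`. -/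
def position {d n : ℕ} (c t : ℝ) (V : Fin (n + 1) → UnitSphere d) (τ : Fin n → ℝ) :
    EuclideanSpace ℝ (Fin d) :=
  c • ∑ k, durations t τ k • (V k : EuclideanSpace ℝ (Fin d))

/-- The random data of a walk which performs `n + 1` steps up to time `t`: independent uniformly
distributed directions, independent of the durations, which have the law `GD(a; b)`. -/
structure IsWalkData {Ω : Type*} [MeasurableSpace Ω] (P : Measure Ω) {d n : ℕ}
    (a b : Fin n → ℝ) (t : ℝ) (V : Fin (n + 1) → Ω → UnitSphere d) (τ : Ω → Fin n → ℝ) :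
    Prop where
  law_dir : ∀ k, HasLaw (V k) (uniformSphere d) P
  law_dur : HasLaw τ (gdMeasure a b t) P
  indep_dir : iIndepFun V P
  indep_dir_dur : IndepFun (fun ω k => V k ω) τ P

end RandomFlight

end

/-! Both the law of `X` and the claimed law are invariant under linear isometries, and a finite
rotation invariant measure is determined by the law of the norm (`ext_of_map_norm_eq`): its
characteristic function is radial, so averaging it over the directions of the frequency leaves an
integral against the law of the norm. It remains to compute the law of `‖X‖`.

Write `d = n + 1`. Given `τ₁ = s` and `V₂ = w`, the norm is `c √(t² - 2 s (t - s) (1 - cos θ))`,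
with `θ` the angle between `V₁` and `w`. The density of `θ` is proportional to `sin θ ^ (n - 1)`
(`lintegral_uniformSphere_inner`). The map from `θ` to the norm is injective on `(0, π)`, and
changing variables turns the sine power into `distKernel` on the interval `(c|2s - t|, ct)`,
whatever `w` is (`lintegral_norm_two_steps`).

Mixing over the Beta law of `s` and exchanging integrals by Tonelli gives the density of `‖X‖` at
`r`. The condition `c|2s - t| < r` becomes the integration interval `t/2 ± r/(2c)` of the theorem.
Division by the area of the sphere of radius `r` gives the density of `X` (`map_position_eq`), and
the rest is Gamma and power bookkeeping. -/

namespace RandomFlight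

/-! ### Polar coordinates and invariance of surface measure. -/

section Polar

variable {E : Type*} [NormedAddCommGroup E] [NormedSpace ℝ E] [Nontrivial E] [MeasurableSpace E]
  [BorelSpace E] [FiniteDimensional ℝ E]

/-- Integration in polar coordinates. -/
theorem lintegral_eq_lintegral_toSphere (μ : Measure E) [μ.IsAddHaarMeasure]
    {F : E → ENNReal} (hF : Measurable F) :
    ∫⁻ x, F x ∂μ = ∫⁻ v, ∫⁻ r in Set.Ioi (0 : ℝ),
      ENNReal.ofReal (r ^ (Module.finrank ℝ E - 1)) * F (r • (v : E)) ∂volume ∂μ.toSphere := by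
  have hG : Measurable fun p : Metric.sphere (0 : E) 1 × Set.Ioi (0 : ℝ) =>
      F ((p.2 : ℝ) • (p.1 : E)) := by fun_prop
  have h := μ.measurePreserving_homeomorphUnitSphereProd.lintegral_comp hG
  -- The polar homeomorphism lives on the complement of the origin, which carries all the mass.
  have h0 : ∫⁻ x, F x ∂μ = ∫⁻ x : ({(0)}ᶜ : Set E), F x ∂(μ.comap (↑)) := by
    rw [lintegral_subtype_comap (measurableSet_singleton _).compl, restrict_compl_singleton]
  rw [h0]
  calc _ = _ := by
        refine (lintegral_congr fun x => ?_).trans h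
        congr 1
        have hx : ‖(x : E)‖ ≠ 0 := norm_ne_zero_iff.2 x.2
        simp [smul_smul, hx]
    _ = _ := by
        rw [lintegral_prod _ hG.aemeasurable]
        refine lintegral_congr fun v => ?_
        rw [Measure.volumeIoiPow, lintegral_withDensity_eq_lintegral_mul _ (by fun_prop)
          (by fun_prop)]
        exact lintegral_subtype_comap measurableSet_Ioi
          (fun r : ℝ => ENNReal.ofReal (r ^ (Module.finrank ℝ E - 1)) * F (r • (v : E)))

/-- Integration of a radial function in polar coordinates. -/
theorem lintegral_norm_eq (μ : Measure E) [μ.IsAddHaarMeasure]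
    {G : ℝ → ENNReal} (hG : Measurable G) :
    ∫⁻ x, G ‖x‖ ∂μ = μ.toSphere Set.univ * ∫⁻ r in Set.Ioi (0 : ℝ),
      ENNReal.ofReal (r ^ (Module.finrank ℝ E - 1)) * G r := by
  rw [lintegral_eq_lintegral_toSphere μ (by fun_prop), mul_comm, ← lintegral_const]
  refine lintegral_congr fun v => setLIntegral_congr_fun measurableSet_Ioi fun r hr => ?_
  simp [norm_smul, abs_of_pos (Set.mem_Ioi.1 hr)]

/-- The mass of `r ^ n` on the unit interval. -/
theorem lintegral_pow_Ioo (n : ℕ) :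
    ∫⁻ r in Set.Ioo (0 : ℝ) 1, ENNReal.ofReal (r ^ n) = ENNReal.ofReal (1 / (n + 1)) := by
  rw [Measure.restrict_congr_set Ioo_ae_eq_Ioc,
    ← ofReal_integral_eq_lintegral_ofReal (intervalIntegral.intervalIntegrable_pow _).1,
    ← intervalIntegral.integral_of_le zero_le_one]
  · simp
  · filter_upwards [ae_restrict_mem measurableSet_Ioc] with y hy
    exact pow_nonneg hy.1.le _

/-- Averages over the sphere as averages over the ball. -/
theorem lintegral_ball_normalize (μ : Measure E) [μ.IsAddHaarMeasure]
    {g : E → ENNReal} (hg : Measurable g) :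
    ∫⁻ x in Metric.ball (0 : E) 1, g (‖x‖⁻¹ • x) ∂μ =
      ENNReal.ofReal (1 / ((Module.finrank ℝ E - 1 : ℕ) + 1)) * ∫⁻ v, g v ∂μ.toSphere := by
  rw [← lintegral_indicator measurableSet_ball, lintegral_eq_lintegral_toSphere μ
    ((by fun_prop : Measurable fun x : E => g (‖x‖⁻¹ • x)).indicator measurableSet_ball),
    ← lintegral_const_mul' _ _ ENNReal.ofReal_ne_top]
  refine lintegral_congr fun v => ?_
  have hI : Set.Ioo (0 : ℝ) 1 = Set.Iio 1 ∩ Set.Ioi 0 := by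
    ext r; simp [and_comm]
  rw [← lintegral_pow_Ioo, ← lintegral_mul_const _ (by fun_prop), hI,
    ← Measure.restrict_restrict measurableSet_Iio, ← lintegral_indicator measurableSet_Iio]
  refine setLIntegral_congr_fun measurableSet_Ioi fun r hr => ?_
  have hr : 0 < r := hr
  by_cases h1 : r < 1
  · simp [Set.indicator, h1, norm_smul, abs_of_pos hr, smul_smul, hr.ne']
  · simp [Set.indicator, h1, norm_smul, abs_of_pos hr]

/-- Surface measure is invariant under linear isometries. -/
theorem lintegral_toSphere_comp_isometry (μ : Measure E) [μ.IsAddHaarMeasure] (R : E ≃ₗᵢ[ℝ] E)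
    (hR : MeasurePreserving R μ μ) {g : E → ENNReal} (hg : Measurable g) :
    ∫⁻ v, g (R v) ∂μ.toSphere = ∫⁻ v, g v ∂μ.toSphere := by
  -- Isometries preserve the volume of the ball and commute with normalization, so invariance is
  -- inherited from the ball averages.
  have h1 := lintegral_ball_normalize μ hg
  have h2 := lintegral_ball_normalize μ (hg.comp R.continuous.measurable)
  have h3 : ∫⁻ x in Metric.ball (0 : E) 1, g (‖x‖⁻¹ • x) ∂μ =
      ∫⁻ x in Metric.ball (0 : E) 1, (g ∘ R) (‖x‖⁻¹ • x) ∂μ := by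
    have hm : Measurable fun x : E => g (‖x‖⁻¹ • x) := by fun_prop
    have := (hR.restrict_preimage (measurableSet_ball (x := (0 : E)) (ε := 1))).lintegral_comp hm
    rw [← this]
    have hp : R ⁻¹' Metric.ball 0 1 = Metric.ball 0 1 := by
      ext x; simp
    rw [hp]
    simp
  rw [h1, h2] at h3
  exact ((ENNReal.mul_right_inj (by simp; positivity) ENNReal.ofReal_ne_top).1 h3).symm

end Polar

/-! ### The uniform law on the sphere. -/

section Sphere

variable {d : ℕ}

instance [NeZero d] : IsProbabilityMeasure (uniformSphere d) where
  measure_univ := by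
    have : Nontrivial (EuclideanSpace ℝ (Fin d)) :=
      Module.nontrivial_of_finrank_pos (R := ℝ) (by simp [Nat.pos_of_neZero])
    rw [uniformSphere, Measure.smul_apply, smul_eq_mul]
    exact ENNReal.inv_mul_cancel ((Measure.measure_univ_ne_zero).2 (Measure.toSphere_ne_zero _)) (by finiteness)

theorem lintegral_uniformSphere_comp_isometry [NeZero d]
    (R : EuclideanSpace ℝ (Fin d) ≃ₗᵢ[ℝ] EuclideanSpace ℝ (Fin d))
    {g : EuclideanSpace ℝ (Fin d) → ENNReal} (hg : Measurable g) :
    ∫⁻ v, g (R v) ∂uniformSphere d = ∫⁻ v, g v ∂uniformSphere d := by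
  have : Nontrivial (EuclideanSpace ℝ (Fin d)) :=
      Module.nontrivial_of_finrank_pos (R := ℝ) (by simp [Nat.pos_of_neZero])
  rw [uniformSphere, lintegral_smul_measure, lintegral_smul_measure,
    lintegral_toSphere_comp_isometry _ R R.measurePreserving hg]

end Sphere

/-! ### Rotation invariant measures and the law of the norm. -/

section Invariant

variable {E : Type*} [NormedAddCommGroup E] [InnerProductSpace ℝ E]

/-- Vectors of equal norm are related by a linear isometry. -/
theorem exists_isometry_apply_eq {x y : E} (h : ‖x‖ = ‖y‖) : ∃ R : E ≃ₗᵢ[ℝ] E, R x = y :=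
  -- The reflection in the hyperplane orthogonal to `x - y`.
  ⟨_, Submodule.reflection_sub h⟩

variable [MeasurableSpace E] [BorelSpace E]

theorem charFun_eq_of_norm_eq {μ : Measure E} (hμ : ∀ R : E ≃ₗᵢ[ℝ] E, μ.map R = μ) {x y : E}
    (h : ‖x‖ = ‖y‖) : charFun μ x = charFun μ y := by
  obtain ⟨R, rfl⟩ := exists_isometry_apply_eq h
  nth_rw 2 [← hμ R]
  rw [charFun_apply, charFun_apply, integral_map R.continuous.aemeasurable
    (by fun_prop)]
  simp

variable [FiniteDimensional ℝ E]

/-- The characteristic function of a rotation invariant measure in terms of the law of the norm. -/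
theorem charFun_eq_integral_norm {μ σ : Measure E} [IsFiniteMeasure μ] [IsProbabilityMeasure σ]
    (hμ : ∀ R : E ≃ₗᵢ[ℝ] E, μ.map R = μ) (hσ : ∀ R : E ≃ₗᵢ[ℝ] E, σ.map R = σ)
    (h1 : ∀ᵐ w ∂σ, ‖w‖ = 1) {e : E} (he : ‖e‖ = 1) (ξ : E) :
    charFun μ ξ = ∫ s, charFun σ ((‖ξ‖ * s) • e) ∂(μ.map norm) := by
  have hm : StronglyMeasurable fun s : ℝ => charFun σ ((‖ξ‖ * s) • e) :=
    stronglyMeasurable_charFun.comp_measurable (by fun_prop)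
  calc charFun μ ξ = ∫ w, charFun μ (‖ξ‖ • w) ∂σ := by
        have : ∀ᵐ w ∂σ, charFun μ (‖ξ‖ • w) = charFun μ ξ := by
          filter_upwards [h1] with w hw
          exact charFun_eq_of_norm_eq hμ (by simp [norm_smul, hw])
        rw [integral_congr_ae this]
        simp
    _ = ∫ w, ∫ x, Complex.exp (inner ℝ x (‖ξ‖ • w) * Complex.I) ∂μ ∂σ := by
        simp only [charFun_apply]
    _ = ∫ x, ∫ w, Complex.exp (inner ℝ x (‖ξ‖ • w) * Complex.I) ∂σ ∂μ := by
        refine integral_integral_swap (Integrable.of_bound (C := 1) ?_ ?_)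
        · refine Continuous.aestronglyMeasurable ?_
          simp only [Function.uncurry_def]
          fun_prop
        · refine .of_forall fun p => ?_
          simp only [Function.uncurry_def]
          rw [Complex.norm_exp_ofReal_mul_I]
    -- The inner integral is the characteristic function of `σ` at `‖ξ‖ • x`; it depends only on the
    -- norm of that vector, which may thus be turned towards `e`.
    _ = ∫ x, charFun σ ((‖ξ‖ * ‖x‖) • e) ∂μ := by
        refine integral_congr_ae (.of_forall fun x => ?_)
        simp only
        rw [charFun_eq_of_norm_eq hσ (x := (‖ξ‖ * ‖x‖) • e) (y := ‖ξ‖ • x)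
          (by simp [norm_smul, he]), charFun_apply]
        simp only [inner_smul_right, real_inner_comm]
    _ = _ := by
        rw [integral_map (by fun_prop) hm.aestronglyMeasurable]

/-- A rotation invariant finite measure is determined by the law of the norm. -/
theorem ext_of_map_norm_eq {μ ν σ : Measure E} [IsFiniteMeasure μ] [IsFiniteMeasure ν]
    [IsProbabilityMeasure σ]
    (hμ : ∀ R : E ≃ₗᵢ[ℝ] E, μ.map R = μ) (hν : ∀ R : E ≃ₗᵢ[ℝ] E, ν.map R = ν)
    (hσ : ∀ R : E ≃ₗᵢ[ℝ] E, σ.map R = σ) (h1 : ∀ᵐ w ∂σ, ‖w‖ = 1)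
    (h : μ.map norm = ν.map norm) : μ = ν := by
  obtain ⟨e, he⟩ := h1.exists
  refine Measure.ext_of_charFun (funext fun ξ => ?_)
  rw [charFun_eq_integral_norm hμ hσ h1 he, charFun_eq_integral_norm hν hσ h1 he, h]

end Invariant

/-! ### The law of the angle to a fixed direction. -/

section Cosine

/-- Splitting off the first coordinate in an integral over Euclidean space. -/
theorem lintegral_coord_norm (n : ℕ) {F : ℝ × ℝ → ENNReal} (hF : Measurable F) :
    ∫⁻ x : EuclideanSpace ℝ (Fin (n + 1)), F (x 0, ‖x‖) =
      ∫⁻ s : ℝ, ∫⁻ y : EuclideanSpace ℝ (Fin n), F (s, √(s ^ 2 + ‖y‖ ^ 2)) := by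
  have h1 := (volume_preserving_piFinSuccAbove (fun _ : Fin (n + 1) => ℝ) 0).comp
    (PiLp.volume_preserving_ofLp (Fin (n + 1)))
  have h2 := ((MeasurePreserving.id (volume : Measure ℝ)).prod
    (PiLp.volume_preserving_toLp (Fin n))).comp h1
  have hG : Measurable fun p : ℝ × EuclideanSpace ℝ (Fin n) =>
      F (p.1, √(p.1 ^ 2 + ‖p.2‖ ^ 2)) := by fun_prop
  have h3 := h2.lintegral_comp hG
  rw [lintegral_prod _ hG.aemeasurable] at h3
  rw [← h3]
  refine lintegral_congr fun x => ?_
  congr 2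
  rw [EuclideanSpace.norm_eq, Fin.sum_univ_succ]
  simp [EuclideanSpace.norm_sq_eq, MeasurableEquiv.piFinSuccAbove, Fin.tail]

/-- The law of one coordinate of a point on the sphere, by its angle. -/
theorem lintegral_toSphere_coord (n : ℕ) [NeZero n] {g : ℝ → ENNReal} (hg : Measurable g) :
    ∫⁻ v, g ((v : EuclideanSpace ℝ (Fin (n + 1))) 0)
        ∂(volume : Measure (EuclideanSpace ℝ (Fin (n + 1)))).toSphere =
      (volume : Measure (EuclideanSpace ℝ (Fin n))).toSphere Set.univ *
        ∫⁻ θ in Set.Ioo 0 Real.pi, ENNReal.ofReal (Real.sin θ ^ (n - 1)) * g (Real.cos θ) := by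
  have hn : Nontrivial (EuclideanSpace ℝ (Fin n)) :=
    Module.nontrivial_of_finrank_pos (R := ℝ) (by simp [Nat.pos_of_neZero])
  set A := (volume : Measure (EuclideanSpace ℝ (Fin n))).toSphere Set.univ with hA
  set F : ℝ × ℝ → ENNReal := fun p => (Set.Iio 1).indicator (fun _ => g (p.2⁻¹ * p.1)) p.2 with hF
  have hFm : Measurable F := by
    have : F = (Prod.snd ⁻¹' Set.Iio 1).indicator (fun p => g (p.2⁻¹ * p.1)) := by
      ext p; simp [F, Set.indicator]
    rw [this]
    exact (by fun_prop : Measurable fun p : ℝ × ℝ => g (p.2⁻¹ * p.1)).indicator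
      (measurable_snd measurableSet_Iio)
  have hb := lintegral_ball_normalize (volume : Measure (EuclideanSpace ℝ (Fin (n + 1))))
    (g := fun x => g (x 0)) (by fun_prop)
  have hl : ∫⁻ x in Metric.ball (0 : EuclideanSpace ℝ (Fin (n + 1))) 1, g ((‖x‖⁻¹ • x) 0) =
      ∫⁻ x : EuclideanSpace ℝ (Fin (n + 1)), F (x 0, ‖x‖) := by
    rw [← lintegral_indicator measurableSet_ball]
    refine lintegral_congr fun x => ?_
    simp [F, Set.indicator]
  have hK : Measurable fun p : ℝ × ℝ => (Set.Ioi 0).indicator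
      (fun ρ => ENNReal.ofReal (ρ ^ (n - 1)) * F (p.1, √(p.1 ^ 2 + ρ ^ 2))) p.2 := by
    have : (fun p : ℝ × ℝ => (Set.Ioi 0).indicator
      (fun ρ => ENNReal.ofReal (ρ ^ (n - 1)) * F (p.1, √(p.1 ^ 2 + ρ ^ 2))) p.2) =
      (Prod.snd ⁻¹' Set.Ioi 0).indicator
        (fun p => ENNReal.ofReal (p.2 ^ (n - 1)) * F (p.1, √(p.1 ^ 2 + p.2 ^ 2))) := by
      ext p; simp [Set.indicator]
    rw [this]
    exact Measurable.indicator (by fun_prop) (measurable_snd measurableSet_Ioi)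
  -- The integrand sees the other `n` coordinates only through their norm `ρ`, so polar coordinates
  -- in `ℝⁿ` leave an integral over the half-plane `ρ > 0`.
  have hr : ∫⁻ x : EuclideanSpace ℝ (Fin (n + 1)), F (x 0, ‖x‖) =
      A * ∫⁻ p : ℝ × ℝ, (Set.Ioi 0).indicator
        (fun ρ => ENNReal.ofReal (ρ ^ (n - 1)) * F (p.1, √(p.1 ^ 2 + ρ ^ 2))) p.2 := by
    rw [lintegral_coord_norm n hFm, Measure.volume_eq_prod, lintegral_prod _ hK.aemeasurable,
      ← lintegral_const_mul _ hK.lintegral_prod_right']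
    refine lintegral_congr fun s => ?_
    have h2 : ∀ y : ℝ, (Set.Ioi 0).indicator (fun ρ => ENNReal.ofReal (ρ ^ (n - 1)) *
        F ((s, y).1, √((s, y).1 ^ 2 + ρ ^ 2))) (s, y).2 = (Set.Ioi 0).indicator (fun ρ =>
        ENNReal.ofReal (ρ ^ (n - 1)) * F (s, √(s ^ 2 + ρ ^ 2))) y := fun _ => rfl
    rw [lintegral_congr h2, lintegral_indicator measurableSet_Ioi]
    have := lintegral_norm_eq (volume : Measure (EuclideanSpace ℝ (Fin n)))
      (G := fun ρ => F (s, √(s ^ 2 + ρ ^ 2))) (by fun_prop)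
    rw [this]
    simp [A]
  -- In planar polar coordinates `ρ > 0` means `θ ∈ (0, π)`, and the variables separate. The
  -- Jacobian raises `r ^ (n - 1)` to `r ^ n`, whose mass `1 / (n + 1)` cancels the constant in
  -- `hb`.
  have hp : ∫⁻ p : ℝ × ℝ, (Set.Ioi 0).indicator
        (fun ρ => ENNReal.ofReal (ρ ^ (n - 1)) * F (p.1, √(p.1 ^ 2 + ρ ^ 2))) p.2 =
      ENNReal.ofReal (1 / (n + 1)) *
        ∫⁻ θ in Set.Ioo 0 Real.pi, ENNReal.ofReal (Real.sin θ ^ (n - 1)) * g (Real.cos θ) := by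
    have hpr : ∀ p ∈ polarCoord.target, ENNReal.ofReal p.1 • (Set.Ioi 0).indicator
        (fun ρ => ENNReal.ofReal (ρ ^ (n - 1)) *
          F ((polarCoord.symm p).1, √((polarCoord.symm p).1 ^ 2 + ρ ^ 2))) (polarCoord.symm p).2 =
        (Set.Iio 1).indicator (fun r => ENNReal.ofReal (r ^ n)) p.1 *
        (Set.Ioi 0).indicator (fun θ => ENNReal.ofReal (Real.sin θ ^ (n - 1)) * g (Real.cos θ))
          p.2 := by
      rintro ⟨r, θ⟩ ⟨hr, hθ⟩
      have hr : 0 < r := hr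
      have hθ : θ ∈ Set.Ioo (-Real.pi) Real.pi := hθ
      have hs : √((r * Real.cos θ) ^ 2 + (r * Real.sin θ) ^ 2) = r := by
        rw [mul_pow, mul_pow, ← mul_add, add_comm, Real.sin_sq_add_cos_sq, mul_one,
          Real.sqrt_sq hr.le]
      simp only [polarCoord_symm_apply]
      rcases le_or_gt θ 0 with h0 | h0
      · have : r * Real.sin θ ≤ 0 :=
          mul_nonpos_of_nonneg_of_nonpos hr.le
            (Real.sin_nonpos_of_nonpos_of_neg_pi_le h0 hθ.1.le)
        rw [Set.indicator_of_notMem (by simpa using this),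
          Set.indicator_of_notMem (s := Set.Ioi 0) (by simpa using h0)]
        simp
      · have hsin : 0 < Real.sin θ := Real.sin_pos_of_pos_of_lt_pi h0 hθ.2
        have : 0 < r * Real.sin θ := mul_pos hr hsin
        rw [Set.indicator_of_mem (by simpa using this),
          Set.indicator_of_mem (s := Set.Ioi 0) (by simpa using h0), hs]
        by_cases h1 : r < 1
        · have hn : r * r ^ (n - 1) = r ^ n := by
            rw [← pow_succ', Nat.sub_add_cancel (Nat.pos_of_neZero n)]
          simp only [F, Set.indicator, Set.mem_Iio, h1, if_true, smul_eq_mul]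
          rw [← mul_assoc, ← ENNReal.ofReal_mul hr.le,
            mul_pow, ← mul_assoc, hn, ENNReal.ofReal_mul (by positivity),
            ← mul_assoc r⁻¹, inv_mul_cancel₀ hr.ne', one_mul, mul_assoc]
        · simp [F, Set.indicator, h1]
    have hI1 : Set.Iio (1 : ℝ) ∩ Set.Ioi 0 = Set.Ioo 0 1 := by
      ext r; simp [and_comm]
    have hI2 : Set.Ioi (0 : ℝ) ∩ Set.Ioo (-Real.pi) Real.pi = Set.Ioo 0 Real.pi := by
      ext r
      simp only [Set.mem_inter_iff, Set.mem_Ioi, Set.mem_Ioo]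
      constructor
      · exact fun h => ⟨h.1, h.2.2⟩
      · exact fun h => ⟨h.1, by linarith [Real.pi_pos], h.2⟩
    rw [← lintegral_comp_polarCoord_symm,
      setLIntegral_congr_fun polarCoord.open_target.measurableSet hpr, polarCoord_target,
      Measure.volume_eq_prod, ← Measure.prod_restrict, lintegral_prod_mul, lintegral_indicator measurableSet_Iio,
      lintegral_indicator measurableSet_Ioi, Measure.restrict_restrict measurableSet_Iio,
      Measure.restrict_restrict measurableSet_Ioi, ← lintegral_pow_Ioo, hI1, hI2]
    · exact (Measurable.indicator (by fun_prop) measurableSet_Iio).aemeasurable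
    · exact (Measurable.indicator (by fun_prop) measurableSet_Ioi).aemeasurable
  have hfin : (Module.finrank ℝ (EuclideanSpace ℝ (Fin (n + 1))) - 1 : ℕ) = n := by simp
  rw [hl, hr, hp, hfin, mul_left_comm] at hb
  exact ((ENNReal.mul_right_inj (by simp; positivity) ENNReal.ofReal_ne_top).1 hb).symm

/-- The total surface area of the unit sphere. -/
theorem toSphere_univ_eq (n : ℕ) [NeZero n] :
    (volume : Measure (EuclideanSpace ℝ (Fin n))).toSphere Set.univ =
      ENNReal.ofReal (2 * Real.pi ^ ((n : ℝ) / 2) / Real.Gamma ((n : ℝ) / 2)) := by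
  have hn : (0 : ℝ) < n := by exact_mod_cast Nat.pos_of_neZero n
  rw [Measure.toSphere_apply_univ, EuclideanSpace.volume_ball, 
    Real.Gamma_add_one (by positivity)]
  simp only [finrank_euclideanSpace, Fintype.card_fin, ENNReal.ofReal_one, one_pow, one_mul]
  rw [← ENNReal.ofReal_natCast, ← ENNReal.ofReal_mul hn.le, Real.sqrt_eq_rpow, ← Real.rpow_natCast,
    ← Real.rpow_mul Real.pi_pos.le]
  congr 1
  have := (Real.Gamma_pos_of_pos (half_pos hn)).ne'
  field_simp

/-- The law of the inner product with a fixed unit vector, by its angle. -/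
theorem lintegral_uniformSphere_inner (n : ℕ) [NeZero n]
    {e : EuclideanSpace ℝ (Fin (n + 1))} (he : ‖e‖ = 1) {g : ℝ → ENNReal} (hg : Measurable g) :
    ∫⁻ v, g (inner ℝ (v : EuclideanSpace ℝ (Fin (n + 1))) e) ∂uniformSphere (n + 1) =
      ENNReal.ofReal (Real.Gamma (((n : ℝ) + 1) / 2) / (√Real.pi * Real.Gamma ((n : ℝ) / 2))) *
        ∫⁻ θ in Set.Ioo 0 Real.pi, ENNReal.ofReal (Real.sin θ ^ (n - 1)) * g (Real.cos θ) := by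
  have hn : (0 : ℝ) < n := by exact_mod_cast Nat.pos_of_neZero n
  obtain ⟨R, hR⟩ := exists_isometry_apply_eq (x := e)
    (y := EuclideanSpace.single (0 : Fin (n + 1)) (1 : ℝ)) (by simp [he])
  have h1 : ∫⁻ v, g (inner ℝ (v : EuclideanSpace ℝ (Fin (n + 1))) e) ∂uniformSphere (n + 1) =
      ∫⁻ v, g ((v : EuclideanSpace ℝ (Fin (n + 1))) 0) ∂uniformSphere (n + 1) := by
    rw [← lintegral_uniformSphere_comp_isometry R
      (g := fun x : EuclideanSpace ℝ (Fin (n + 1)) => g (x 0)) (by fun_prop)]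
    refine lintegral_congr fun v => ?_
    rw [← R.inner_map_map, hR]
    simp [EuclideanSpace.inner_single_right]
  rw [h1, uniformSphere, lintegral_smul_measure, lintegral_toSphere_coord n hg,
    toSphere_univ_eq, toSphere_univ_eq, smul_eq_mul, ← mul_assoc]
  -- The constant is the area of the sphere in `ℝⁿ` divided by that of the sphere in `ℝⁿ⁺¹`.
  congr 1
  have hG1 := Real.Gamma_pos_of_pos (half_pos hn)
  have hG2 := Real.Gamma_pos_of_pos (by positivity : 0 < ((n : ℝ) + 1) / 2)
  rw [← ENNReal.ofReal_inv_of_pos (by push_cast; positivity), ← ENNReal.ofReal_mul (by positivity)]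
  congr 1
  push_cast
  rw [add_div, Real.rpow_add Real.pi_pos, ← Real.sqrt_eq_rpow]
  have := Real.rpow_pos_of_pos Real.pi_pos ((n : ℝ) / 2)
  rw [add_div] at hG2
  field_simp

end Cosine

/-! ### The distance covered by two steps of given durations. -/

section Norm

/-- The density of the distance covered by two steps of durations `τ` and `t - τ`, up to a
constant. -/
noncomputable def distKernel (n : ℕ) (c t τ r : ℝ) : ℝ :=
  r * (c ^ 2 * t ^ 2 - r ^ 2) ^ (((n : ℝ) - 2) / 2) *
    (4 * c ^ 2 * τ * (t - τ) - c ^ 2 * t ^ 2 + r ^ 2) ^ (((n : ℝ) - 2) / 2) *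
    (τ * (t - τ)) ^ (1 - (n : ℝ)) / ((2 : ℝ) ^ ((n : ℝ) - 2) * c ^ (2 * (n : ℝ) - 2))

theorem measurable_distKernel (n : ℕ) (c t : ℝ) :
    Measurable fun p : ℝ × ℝ => distKernel n c t p.1 p.2 := by
  unfold distKernel
  fun_prop

/-- The distance covered by two steps whose directions make an angle `θ`. -/
noncomputable def stepDist (c t τ θ : ℝ) : ℝ := c * √(t ^ 2 - 2 * (τ * (t - τ)) * (1 - Real.cos θ))

theorem norm_two_steps {E : Type*} [NormedAddCommGroup E] [InnerProductSpace ℝ E] {c t τ : ℝ}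
    (hc : 0 < c) {v e : E} (hv : ‖v‖ = 1) (he : ‖e‖ = 1) :
    ‖c • (τ • v + (t - τ) • e)‖ = c * √(t ^ 2 - 2 * (τ * (t - τ)) * (1 - inner ℝ v e)) := by
  rw [norm_smul, Real.norm_of_nonneg hc.le]
  congr 1
  have h : ‖τ • v + (t - τ) • e‖ ^ 2 = t ^ 2 - 2 * (τ * (t - τ)) * (1 - inner ℝ v e) := by
    rw [norm_add_sq_real, norm_smul, norm_smul, hv, he, inner_smul_left, inner_smul_right]
    simp only [mul_one, Real.norm_eq_abs, sq_abs, conj_trivial]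
    ring
  rw [← h, Real.sqrt_sq (norm_nonneg _)]

variable {c t τ : ℝ}

theorem sq_lt_radicand (h0 : 0 < τ) (h1 : τ < t) {θ : ℝ} (hθ : θ ∈ Set.Ioo 0 Real.pi) :
    (2 * τ - t) ^ 2 < t ^ 2 - 2 * (τ * (t - τ)) * (1 - Real.cos θ) := by
  have hT : 0 < τ * (t - τ) := mul_pos h0 (sub_pos.2 h1)
  have hm := Real.strictAntiOn_cos ⟨hθ.1.le, hθ.2.le⟩ ⟨Real.pi_pos.le, le_rfl⟩ hθ.2
  rw [Real.cos_pi] at hm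
  nlinarith

theorem radicand_pos (h0 : 0 < τ) (h1 : τ < t) {θ : ℝ} (hθ : θ ∈ Set.Ioo 0 Real.pi) :
    0 < t ^ 2 - 2 * (τ * (t - τ)) * (1 - Real.cos θ) :=
  (sq_nonneg _).trans_lt (sq_lt_radicand h0 h1 hθ)

theorem injOn_stepDist (hc : 0 < c) (h0 : 0 < τ) (h1 : τ < t) :
    Set.InjOn (stepDist c t τ) (Set.Ioo 0 Real.pi) := by
  intro x hx y hy hxy
  have hT : 0 < τ * (t - τ) := mul_pos h0 (sub_pos.2 h1)
  refine Real.injOn_cos ⟨hx.1.le, hx.2.le⟩ ⟨hy.1.le, hy.2.le⟩ ?_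
  have h := mul_left_cancel₀ hc.ne' hxy
  rw [Real.sqrt_inj (radicand_pos h0 h1 hx).le (radicand_pos h0 h1 hy).le] at h
  have h2 : 2 * (τ * (t - τ)) * (Real.cos x - Real.cos y) = 0 := by linarith
  rcases mul_eq_zero.1 h2 with h | h <;> linarith

/-- Parallel steps (`θ = 0`) give `ct` and opposite ones (`θ = π`) give `c|2τ - t|`. Conversely, an
intermediate distance determines the cosine of the angle, which lies strictly between `-1` and `1`.
-/
theorem image_stepDist (hc : 0 < c) (h0 : 0 < τ) (h1 : τ < t) :
    stepDist c t τ '' Set.Ioo 0 Real.pi = Set.Ioo (c * |2 * τ - t|) (c * t) := by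
  have hT : 0 < τ * (t - τ) := mul_pos h0 (sub_pos.2 h1)
  have ht : 0 < t := h0.trans h1
  ext r
  constructor
  · rintro ⟨θ, hθ, rfl⟩
    constructor
    · refine mul_lt_mul_of_pos_left ?_ hc
      rw [← Real.sqrt_sq_eq_abs]
      exact Real.sqrt_lt_sqrt (sq_nonneg _) (sq_lt_radicand h0 h1 hθ)
    · refine mul_lt_mul_of_pos_left ?_ hc
      rw [Real.sqrt_lt' ht]
      have hm := Real.strictAntiOn_cos ⟨le_rfl, Real.pi_pos.le⟩ ⟨hθ.1.le, hθ.2.le⟩ hθ.1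
      rw [Real.cos_zero] at hm
      nlinarith
  · rintro ⟨hl, hr⟩
    obtain ⟨s, rfl⟩ : ∃ s, r = c * s := ⟨r / c, by field_simp⟩
    have hl := lt_of_mul_lt_mul_left hl hc.le
    have hr := lt_of_mul_lt_mul_left hr hc.le
    have hs : 0 < s := (abs_nonneg _).trans_lt hl
    have hl2 : (2 * τ - t) ^ 2 < s ^ 2 := by
      rw [← sq_abs]; exact pow_lt_pow_left₀ hl (abs_nonneg _) two_ne_zero
    have hr2 : s ^ 2 < t ^ 2 := pow_lt_pow_left₀ hr hs.le two_ne_zero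
    -- The cosine for which the radicand equals `s ^ 2`.
    set u := 1 - (t ^ 2 - s ^ 2) / (2 * (τ * (t - τ))) with hu
    have hu' : 2 * (τ * (t - τ)) * (1 - u) = t ^ 2 - s ^ 2 := by
      rw [hu, sub_sub_cancel, mul_div_cancel₀]; positivity
    have hu1 : u < 1 := by nlinarith
    have hu2 : -1 < u := by nlinarith
    refine ⟨Real.arccos u, ⟨Real.arccos_pos.2 hu1, ?_⟩, ?_⟩
    · refine lt_of_le_of_ne (Real.arccos_le_pi _) fun h => ?_
      exact absurd (Real.arccos_eq_pi.1 h) (not_le.2 hu2)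
    · rw [stepDist, Real.cos_arccos hu2.le hu1.le, hu', sub_sub_cancel, Real.sqrt_sq hs.le]

theorem hasDerivAt_stepDist (h0 : 0 < τ) (h1 : τ < t) {θ : ℝ} (hθ : θ ∈ Set.Ioo 0 Real.pi) :
    HasDerivAt (stepDist c t τ) (-(c * (τ * (t - τ)) * Real.sin θ /
      √(t ^ 2 - 2 * (τ * (t - τ)) * (1 - Real.cos θ)))) θ := by
  have h := ((((Real.hasDerivAt_cos θ).const_sub 1).const_mul (2 * (τ * (t - τ)))).const_sub
    (t ^ 2)).sqrt (radicand_pos h0 h1 hθ).ne'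
  refine (h.const_mul c).congr_deriv ?_
  field_simp

/-- `distKernel` is the sine power transported by the change of variables: this identity cancels the
Jacobian. -/
theorem deriv_mul_distKernel (n : ℕ) [NeZero n] (hc : 0 < c) (h0 : 0 < τ) (h1 : τ < t) {θ : ℝ}
    (hθ : θ ∈ Set.Ioo 0 Real.pi) :
    |-(c * (τ * (t - τ)) * Real.sin θ / √(t ^ 2 - 2 * (τ * (t - τ)) * (1 - Real.cos θ)))| *
      distKernel n c t τ (stepDist c t τ θ) = Real.sin θ ^ (n - 1) := by
  have hT : 0 < τ * (t - τ) := mul_pos h0 (sub_pos.2 h1)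
  have hs : 0 < Real.sin θ := Real.sin_pos_of_mem_Ioo hθ
  have hf := radicand_pos h0 h1 hθ
  have hq : stepDist c t τ θ ^ 2 = c ^ 2 * (t ^ 2 - 2 * (τ * (t - τ)) * (1 - Real.cos θ)) := by
    rw [stepDist, mul_pow, Real.sq_sqrt hf.le]
  have hn : Real.sin θ ^ (n - 1) = Real.sin θ ^ ((n : ℝ) - 2) * Real.sin θ := by
    rw [← Real.rpow_natCast, Nat.cast_sub (Nat.pos_of_neZero n), ← Real.rpow_add_one hs.ne']
    congr 1
    push_cast
    ring
  have hu1 : 0 ≤ 1 - Real.cos θ := by linarith [Real.cos_le_one θ]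
  have hu2 : 0 ≤ 1 + Real.cos θ := by linarith [Real.neg_one_le_cos θ]
  -- The two bases are `2c²τ(t - τ)(1 ∓ cos θ)`, so their product is the square of `2c²τ(t - τ) sin
  -- θ`.
  have hA : (c ^ 2 * t ^ 2 - stepDist c t τ θ ^ 2) ^ (((n : ℝ) - 2) / 2) *
      (4 * c ^ 2 * τ * (t - τ) - c ^ 2 * t ^ 2 + stepDist c t τ θ ^ 2) ^ (((n : ℝ) - 2) / 2) =
      2 ^ ((n : ℝ) - 2) * (c ^ 2) ^ ((n : ℝ) - 2) * (τ * (t - τ)) ^ ((n : ℝ) - 2) *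
        Real.sin θ ^ ((n : ℝ) - 2) := by
    have e1 : c ^ 2 * t ^ 2 - stepDist c t τ θ ^ 2 =
        2 * c ^ 2 * (τ * (t - τ)) * (1 - Real.cos θ) := by rw [hq]; ring
    have e2 : 4 * c ^ 2 * τ * (t - τ) - c ^ 2 * t ^ 2 + stepDist c t τ θ ^ 2 =
        2 * c ^ 2 * (τ * (t - τ)) * (1 + Real.cos θ) := by rw [hq]; ring
    rw [e1, e2, ← Real.mul_rpow (by positivity) (by positivity)]
    have e3 : 2 * c ^ 2 * (τ * (t - τ)) * (1 - Real.cos θ) *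
        (2 * c ^ 2 * (τ * (t - τ)) * (1 + Real.cos θ)) =
        (2 * c ^ 2 * (τ * (t - τ)) * Real.sin θ) ^ (2 : ℝ) := by
      rw [Real.rpow_two, mul_pow _ (Real.sin θ), Real.sin_sq]
      ring
    rw [e3, ← Real.rpow_mul (by positivity), mul_div_cancel₀ _ two_ne_zero,
      Real.mul_rpow (by positivity) hs.le, Real.mul_rpow (by positivity) hT.le,
      Real.mul_rpow (by positivity) (by positivity)]
  have hc2 : c ^ (2 * (n : ℝ) - 2) = (c ^ 2) ^ ((n : ℝ) - 2) * c ^ 2 := by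
    rw [← Real.rpow_two, ← Real.rpow_mul hc.le, ← Real.rpow_add hc]
    congr 1
    ring
  have hT2 : (τ * (t - τ)) ^ (1 - (n : ℝ)) =
      ((τ * (t - τ)) ^ ((n : ℝ) - 2))⁻¹ * (τ * (t - τ))⁻¹ := by
    rw [← Real.rpow_neg hT.le, ← Real.rpow_neg_one (τ * (t - τ)), ← Real.rpow_add hT]
    congr 1
    ring
  rw [abs_neg, abs_of_nonneg (by positivity), distKernel, mul_assoc (stepDist c t τ θ), hA, hc2,
    hT2, hn, stepDist]
  have p1 := Real.rpow_pos_of_pos hT ((n : ℝ) - 2)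
  have p2 := Real.rpow_pos_of_pos (pow_pos hc 2) ((n : ℝ) - 2)
  have p3 := Real.rpow_pos_of_pos (two_pos (α := ℝ)) ((n : ℝ) - 2)
  have p4 := Real.sqrt_pos.2 hf
  set x1 := (τ * (t - τ)) ^ ((n : ℝ) - 2)
  set x2 := (c ^ 2) ^ ((n : ℝ) - 2)
  set x3 := (2 : ℝ) ^ ((n : ℝ) - 2)
  set x4 := √(t ^ 2 - 2 * (τ * (t - τ)) * (1 - Real.cos θ))
  set x5 := τ * (t - τ)
  field_simp

/-- The law of the distance covered by two steps, the second of which has a given direction. -/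
theorem lintegral_norm_two_steps (n : ℕ) [NeZero n] (hc : 0 < c) (h0 : 0 < τ) (h1 : τ < t)
    {e : EuclideanSpace ℝ (Fin (n + 1))} (he : ‖e‖ = 1) {G : ℝ → ENNReal} (hG : Measurable G) :
    ∫⁻ v, G ‖c • (τ • (v : EuclideanSpace ℝ (Fin (n + 1))) + (t - τ) • e)‖
        ∂uniformSphere (n + 1) =
      ENNReal.ofReal (Real.Gamma (((n : ℝ) + 1) / 2) / (√Real.pi * Real.Gamma ((n : ℝ) / 2))) *
        ∫⁻ r in Set.Ioo (c * |2 * τ - t|) (c * t), ENNReal.ofReal (distKernel n c t τ r) * G r := by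
  have hv : ∀ v : UnitSphere (n + 1),
      G ‖c • (τ • (v : EuclideanSpace ℝ (Fin (n + 1))) + (t - τ) • e)‖ =
      (fun u => G (c * √(t ^ 2 - 2 * (τ * (t - τ)) * (1 - u))))
        (inner ℝ (v : EuclideanSpace ℝ (Fin (n + 1))) e) :=
    fun v => by rw [norm_two_steps hc (by simp) he]
  rw [lintegral_congr hv, lintegral_uniformSphere_inner n he
      (g := fun u => G (c * √(t ^ 2 - 2 * (τ * (t - τ)) * (1 - u)))) (by fun_prop),
    ← image_stepDist hc h0 h1, lintegral_image_eq_lintegral_abs_deriv_mul measurableSet_Ioo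
      (fun θ hθ => (hasDerivAt_stepDist h0 h1 hθ).hasDerivWithinAt) (injOn_stepDist hc h0 h1)]
  congr 1
  refine setLIntegral_congr_fun measurableSet_Ioo fun θ hθ => ?_
  rw [← deriv_mul_distKernel n hc h0 h1 hθ, ENNReal.ofReal_mul (abs_nonneg _), mul_assoc]
  rfl

end Norm

/-! ### Integrability of the integrand in the density. -/

section Integrability

theorem intervalIntegrable_rpow_mul_rpow {p l h : ℝ} (hp : -1 < p) (hlh : l ≤ h) :
    IntervalIntegrable (fun x => (x - l) ^ p * (h - x) ^ p) volume l h := by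
  rcases hlh.eq_or_lt with rfl | hlt
  · exact IntervalIntegrable.refl
  have key : ∀ (q : ℝ) {a b : ℝ}, IntervalIntegrable (fun x => (x - q) ^ p) volume a b := by
    intro q a b
    have := (intervalIntegral.intervalIntegrable_rpow' (a := a - q) (b := b - q) hp).comp_sub_right q
      (by simp)
    simpa using this
  have key' : ∀ (q : ℝ) {a b : ℝ}, IntervalIntegrable (fun x => (q - x) ^ p) volume a b := by
    intro q a b
    have := (intervalIntegral.intervalIntegrable_rpow' (a := q - a) (b := q - b) hp).comp_sub_left q
      (by simp)
    simpa using this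
  -- Each half of the interval contains only one of the two endpoint singularities, and there `p >
  -- -1` suffices.
  refine IntervalIntegrable.trans (b := (l + h) / 2) ?_ ?_
  · refine (key l).mul_continuousOn fun x hx => ?_
    rw [Set.uIcc_of_le (by linarith)] at hx
    exact (ContinuousAt.rpow_const (f := fun x => h - x) (by fun_prop)
      (Or.inl (sub_pos.2 (by linarith [hx.2])).ne')).continuousWithinAt
  · refine (key' h).continuousOn_mul fun x hx => ?_
    rw [Set.uIcc_of_le (by linarith)] at hx
    exact (ContinuousAt.rpow_const (f := fun x => x - l) (by fun_prop)
      (Or.inl (sub_pos.2 (by linarith [hx.1])).ne')).continuousWithinAt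

/-- The bracket factors as `4c²(τ - l)(h - τ)`, with `l`, `h` the ends of the interval. Since `r <
ct`, these lie strictly inside `(0, t)`, so the powers of `τ` and `t - τ` are continuous for all
exponents. -/
theorem intervalIntegrable_density {c t r p α β : ℝ} (hc : 0 < c) (hr : 0 ≤ r) (hrt : r < c * t)
    (hp : -1 < p) :
    IntervalIntegrable (fun τ : ℝ => τ ^ α * (t - τ) ^ β *
      (4 * c ^ 2 * τ * (t - τ) - c ^ 2 * t ^ 2 + r ^ 2) ^ p) volume
      (t / 2 - r / (2 * c)) (t / 2 + r / (2 * c)) := by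
  have hrc : r / (2 * c) < t / 2 := by
    rw [div_lt_div_iff₀ (by positivity) two_pos]; linarith
  have hrc0 : 0 ≤ r / (2 * c) := by positivity
  set l := t / 2 - r / (2 * c) with hl
  set h := t / 2 + r / (2 * c) with hh
  have hlh : l ≤ h := by linarith
  have h1 := ((intervalIntegrable_rpow_mul_rpow hp hlh).const_mul ((4 * c ^ 2) ^ p))
  have h2 : IntervalIntegrable (fun τ : ℝ => τ ^ α * (t - τ) ^ β *
      ((4 * c ^ 2) ^ p * ((τ - l) ^ p * (h - τ) ^ p))) volume l h := by
    refine h1.continuousOn_mul fun x hx => ?_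
    rw [Set.uIcc_of_le hlh] at hx
    exact ((ContinuousAt.rpow_const (f := fun x => x) (by fun_prop)
      (Or.inl (by linarith [hx.1] : 0 < x).ne')).mul
      (ContinuousAt.rpow_const (f := fun x => t - x) (by fun_prop)
      (Or.inl (sub_pos.2 (by linarith [hx.2])).ne'))).continuousWithinAt
  refine h2.congr fun x hx => ?_
  rw [Set.uIoc_of_le hlh] at hx
  have e1 : 0 ≤ x - l := by linarith [hx.1]
  have e2 : 0 ≤ h - x := by linarith [hx.2]
  rw [← Real.mul_rpow e1 e2, ← Real.mul_rpow (by positivity) (by positivity)]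
  congr 2
  rw [hl, hh]
  field_simp
  ring

end Integrability

/-! ### The law of the walk as an iterated integral. -/

section Walk

/-- The rescaled Beta density. -/
noncomputable def betaDensity (a b t s : ℝ) : ℝ :=
  1 / t ^ (a + b - 1) * (Real.Gamma (a + b) / (Real.Gamma a * Real.Gamma b)) *
    (s ^ (a - 1) * (t - s) ^ (b - 1))

theorem measurable_betaDensity (a b t : ℝ) : Measurable (betaDensity a b t) := by
  unfold betaDensity
  fun_prop

theorem lintegral_gdMeasure_one (a b t : ℝ) {h : ℝ → ENNReal} (hh : Measurable h) :
    ∫⁻ τ, h (τ 0) ∂gdMeasure (n := 1) (fun _ => a) (fun _ => b) t =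
      ∫⁻ s in Set.Ioo 0 t, ENNReal.ofReal (betaDensity a b t s) * h s := by
  have hd : ∀ τ : Fin 1 → ℝ, gdDensity (fun _ => a) (fun _ => b) t τ = betaDensity a b t (τ 0) := by
    intro τ
    have h3 : Finset.Iic (0 : Fin 1) = {0} := rfl
    simp [gdDensity, gdConst, betaDensity, h3]
  have hs : simplex 1 t = MeasurableEquiv.funUnique (Fin 1) ℝ ⁻¹' Set.Ioo 0 t := by
    ext τ
    have h4 : Finset.Iio (0 : Fin 1) = ∅ := rfl
    simp [simplex, h4]
  have hb : Measurable fun s => ENNReal.ofReal (betaDensity a b t s) * h s :=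
    (measurable_betaDensity a b t).ennreal_ofReal.mul hh
  have hb' : Measurable fun τ : Fin 1 → ℝ => ENNReal.ofReal (betaDensity a b t (τ 0)) :=
    ((measurable_betaDensity a b t).comp (measurable_pi_apply 0)).ennreal_ofReal
  simp only [gdMeasure, hd]
  rw [lintegral_withDensity_eq_lintegral_mul _ hb' (by fun_prop), hs,
    ← (volume_preserving_funUnique (Fin 1) ℝ).setLIntegral_comp_preimage measurableSet_Ioo hb]
  rfl

theorem position_two {d : ℕ} (c t : ℝ) (V : Fin 2 → UnitSphere d) (τ : Fin 1 → ℝ) :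
    position c t V τ = c • (τ 0 • (V 0 : EuclideanSpace ℝ (Fin d)) +
      (t - τ 0) • (V 1 : EuclideanSpace ℝ (Fin d))) := by
  have h0 : durations t τ 0 = τ 0 := rfl
  have h1 : durations t τ 1 = t - ∑ j, τ j := rfl
  rw [position, Fin.sum_univ_two, h0, h1, Fin.sum_univ_one]

theorem measurable_two_steps {d : ℕ} (c t : ℝ) :
    Measurable fun p : (Fin 2 → UnitSphere d) × (Fin 1 → ℝ) => position c t p.1 p.2 := by
  simp only [position_two]
  fun_prop

variable {Ω : Type*} [MeasurableSpace Ω] {P : Measure Ω} {d : ℕ}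
  {a b c t : ℝ} {V : Fin 2 → Ω → UnitSphere d} {τ : Ω → Fin 1 → ℝ}

theorem aemeasurable_position (h : IsWalkData P (fun _ => a) (fun _ => b) t V τ) :
    AEMeasurable (fun ω => position c t (fun k => V k ω) (τ ω)) P :=
  (measurable_two_steps c t).comp_aemeasurable (f := fun ω => ((fun k => V k ω), τ ω))
    ((aemeasurable_pi_lambda _ fun k => (h.law_dir k).aemeasurable).prodMk h.law_dur.aemeasurable)

variable [IsProbabilityMeasure P] [NeZero d]

/-- The law of a walk with two steps as an iterated integral. -/
theorem lintegral_map_position (h : IsWalkData P (fun _ => a) (fun _ => b) t V τ)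
    {f : EuclideanSpace ℝ (Fin d) → ENNReal} (hf : Measurable f) :
    ∫⁻ x, f x ∂(P.map fun ω => position c t (fun k => V k ω) (τ ω)) =
      ∫⁻ s in Set.Ioo 0 t, ENNReal.ofReal (betaDensity a b t s) *
        ∫⁻ w, ∫⁻ v, f (c • (s • (v : EuclideanSpace ℝ (Fin d)) + (t - s) •
          (w : EuclideanSpace ℝ (Fin d)))) ∂uniformSphere d ∂uniformSphere d := by
  have hV : AEMeasurable (fun ω k => V k ω) P :=
    aemeasurable_pi_lambda _ fun k => (h.law_dir k).aemeasurable
  have hτ := h.law_dur.aemeasurable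
  -- Finiteness comes from being the law of `τ`; no Beta integral is computed.
  have hfin : IsFiniteMeasure (gdMeasure (n := 1) (fun _ => a) (fun _ => b) t) := by
    rw [← h.law_dur.map_eq]; infer_instance
  have hVl : P.map (fun ω k => V k ω) = Measure.pi fun _ => uniformSphere d := by
    rw [(iIndepFun_iff_map_fun_eq_pi_map fun k => (h.law_dir k).aemeasurable).1 h.indep_dir]
    congr 1
    funext k
    exact (h.law_dir k).map_eq
  have hj : P.map (fun ω => ((fun k => V k ω), τ ω)) =
      (Measure.pi fun _ => uniformSphere d).prod (gdMeasure (fun _ => a) (fun _ => b) t) := by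
    rw [h.indep_dir_dur.map_prod_eq_prod_map_map hV hτ, hVl, h.law_dur.map_eq]
  have hF : Measurable fun p : (Fin 2 → UnitSphere d) × (Fin 1 → ℝ) =>
      f (position c t p.1 p.2) := hf.comp (measurable_two_steps c t)
  have hF2 : Measurable fun p : ((UnitSphere d) × (UnitSphere d)) × ℝ =>
      f (c • (p.2 • (p.1.1 : EuclideanSpace ℝ (Fin d)) + (t - p.2) •
          (p.1.2 : EuclideanSpace ℝ (Fin d)))) := by fun_prop
  rw [lintegral_map' hf.aemeasurable (aemeasurable_position h)]
  calc _ = ∫⁻ p, f (position c t p.1 p.2)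
        ∂(P.map (fun ω => ((fun k => V k ω), τ ω))) := by
        rw [lintegral_map' hF.aemeasurable (hV.prodMk hτ)]
    _ = ∫⁻ τ, ∫⁻ V, f (position c t V τ) ∂(Measure.pi fun _ => uniformSphere d)
        ∂(gdMeasure (fun _ => a) (fun _ => b) t) := by
        rw [hj, lintegral_prod_symm _ hF.aemeasurable]
    _ = ∫⁻ τ, (fun s => ∫⁻ p, f (c • (s • (p.1 : EuclideanSpace ℝ (Fin d)) + (t - s) •
          (p.2 : EuclideanSpace ℝ (Fin d)))) ∂((uniformSphere d).prod (uniformSphere d))) (τ 0)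
        ∂(gdMeasure (fun _ => a) (fun _ => b) t) := by
        refine lintegral_congr fun τ => ?_
        simp only
        have hF3 : Measurable fun p : UnitSphere d × UnitSphere d =>
          f (c • (τ 0 • (p.1 : EuclideanSpace ℝ (Fin d)) + (t - τ 0) •
            (p.2 : EuclideanSpace ℝ (Fin d)))) := by fun_prop
        rw [← (measurePreserving_finTwoArrow (uniformSphere d)).lintegral_comp hF3]
        simp only [position_two]
        rfl
    _ = _ := by
        rw [lintegral_gdMeasure_one a b t hF2.lintegral_prod_left']
        refine lintegral_congr fun s => ?_
        congr 1
        exact lintegral_prod_symm _ (hF2.comp measurable_prodMk_right).aemeasurable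

/-- By linearity an isometry acts on both directions at once, and each direction has an invariant
law. -/
theorem map_isometry_map_position (h : IsWalkData P (fun _ => a) (fun _ => b) t V τ)
    (R : EuclideanSpace ℝ (Fin d) ≃ₗᵢ[ℝ] EuclideanSpace ℝ (Fin d)) :
    (P.map fun ω => position c t (fun k => V k ω) (τ ω)).map R =
      P.map fun ω => position c t (fun k => V k ω) (τ ω) := by
  refine Measure.ext_of_lintegral _ fun f hf => ?_
  have hR : Measurable R := R.continuous.measurable
  rw [lintegral_map hf hR, lintegral_map_position h (f := fun x => f (R x)) (hf.comp hR),
    lintegral_map_position h hf]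
  refine lintegral_congr fun s => ?_
  congr 1
  have hF2 : Measurable fun p : EuclideanSpace ℝ (Fin d) × UnitSphere d =>
      f (c • (s • (p.2 : EuclideanSpace ℝ (Fin d)) + (t - s) • p.1)) := by fun_prop
  rw [← lintegral_uniformSphere_comp_isometry R (g := fun w =>
    ∫⁻ v, f (c • (s • (v : EuclideanSpace ℝ (Fin d)) + (t - s) • w)) ∂uniformSphere d)
    hF2.lintegral_prod_right']
  refine lintegral_congr fun w => ?_
  rw [← lintegral_uniformSphere_comp_isometry R (g := fun v =>
    f (c • (s • v + (t - s) • R (w : EuclideanSpace ℝ (Fin d))))) (by fun_prop)]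
  simp

end Walk

/-! ### Measures with a radial density. -/

section Radial

variable {E : Type*} [NormedAddCommGroup E] [InnerProductSpace ℝ E] [MeasurableSpace E]
  [BorelSpace E] [FiniteDimensional ℝ E]

/-- A measure with a radial density is rotation invariant. -/
theorem map_isometry_withDensity_norm {H : ℝ → ENNReal} (hH : Measurable H) (ρ : ℝ)
    (R : E ≃ₗᵢ[ℝ] E) :
    (((volume : Measure E).restrict (Metric.ball 0 ρ)).withDensity fun x => H ‖x‖).map R =
      ((volume : Measure E).restrict (Metric.ball 0 ρ)).withDensity fun x => H ‖x‖ := by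
  refine Measure.ext_of_lintegral _ fun f hf => ?_
  have hR : Measurable R := R.continuous.measurable
  have hp : R ⁻¹' Metric.ball 0 ρ = Metric.ball 0 ρ := by
    ext x; simp
  rw [lintegral_map hf hR, lintegral_withDensity_eq_lintegral_mul _ (by fun_prop) (by fun_prop),
    lintegral_withDensity_eq_lintegral_mul _ (by fun_prop) (by fun_prop),
    ← R.measurePreserving.setLIntegral_comp_preimage measurableSet_ball
      ((by fun_prop : Measurable fun x : E => H ‖x‖).mul hf), hp]
  simp

theorem lintegral_norm_withDensity_norm [Nontrivial E] {H G : ℝ → ENNReal} (hH : Measurable H)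
    (hG : Measurable G) (ρ : ℝ) :
    ∫⁻ x, G ‖x‖ ∂(((volume : Measure E).restrict (Metric.ball 0 ρ)).withDensity fun x => H ‖x‖) =
      (volume : Measure E).toSphere Set.univ * ∫⁻ r in Set.Ioo 0 ρ,
        ENNReal.ofReal (r ^ (Module.finrank ℝ E - 1)) * H r * G r := by
  have hI : Set.Ioo 0 ρ = Set.Iio ρ ∩ Set.Ioi 0 := by
    ext r; simp [and_comm]
  rw [lintegral_withDensity_eq_lintegral_mul _ (by fun_prop) (by fun_prop),
    ← lintegral_indicator measurableSet_ball, hI, ← Measure.restrict_restrict measurableSet_Iio,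
    ← lintegral_indicator measurableSet_Iio]
  have h := lintegral_norm_eq (volume : Measure E) ((hH.mul hG).indicator (measurableSet_Iio (a := ρ)))
  calc _ = ∫⁻ x : E, (Set.Iio ρ).indicator (H * G) ‖x‖ := by
        refine lintegral_congr fun x => ?_
        simp [Set.indicator]
    _ = _ := by
        rw [h]
        congr 1
        refine lintegral_congr fun r => ?_
        by_cases hr : r < ρ <;> simp [Set.indicator, hr, mul_assoc]

end Radial

/-! ### The density of the norm and of the position. -/

section Density

/-- The normalizing constant of the law of the angle between two directions. -/
noncomputable def angleConst (n : ℕ) : ℝ :=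
  Real.Gamma (((n : ℝ) + 1) / 2) / (√Real.pi * Real.Gamma ((n : ℝ) / 2))

/-- The joint density of the duration of the first step and the distance from the origin. -/
noncomputable def jointDensity (n : ℕ) (a b c t : ℝ) : ℝ × ℝ → ENNReal :=
  {p : ℝ × ℝ | c * |2 * p.1 - t| < p.2}.indicator fun p =>
    ENNReal.ofReal (betaDensity a b t p.1) *
      (ENNReal.ofReal (angleConst n) * ENNReal.ofReal (distKernel n c t p.1 p.2))

theorem measurable_jointDensity (n : ℕ) (a b c t : ℝ) : Measurable (jointDensity n a b c t) := by
  refine Measurable.indicator ?_ (measurableSet_lt (by fun_prop) (by fun_prop))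
  exact ((measurable_betaDensity a b t).comp measurable_fst).ennreal_ofReal.mul
    (measurable_const.mul (measurable_distKernel n c t).ennreal_ofReal)

/-- The density of the distance from the origin. -/
noncomputable def normDensity (n : ℕ) (a b c t r : ℝ) : ENNReal :=
  ∫⁻ s in Set.Ioo 0 t, jointDensity n a b c t (s, r)

theorem measurable_normDensity (n : ℕ) (a b c t : ℝ) : Measurable (normDensity n a b c t) :=
  (measurable_jointDensity n a b c t).lintegral_prod_left'

/-- The density of the position, as a function of the distance from the origin. -/
noncomputable def radialDensity (n : ℕ) (a b c t r : ℝ) : ENNReal :=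
  ((volume : Measure (EuclideanSpace ℝ (Fin (n + 1)))).toSphere Set.univ)⁻¹ *
    ((ENNReal.ofReal (r ^ n))⁻¹ * normDensity n a b c t r)

theorem measurable_radialDensity (n : ℕ) (a b c t : ℝ) : Measurable (radialDensity n a b c t) := by
  have := measurable_normDensity n a b c t
  unfold radialDensity
  fun_prop

theorem betaDensity_mul_distKernel {n : ℕ} {a b c t s r : ℝ} (h0 : 0 < s) (h1 : s < t) :
    betaDensity a b t s * (angleConst n * distKernel n c t s r) =
      (1 / t ^ (a + b - 1) * (Real.Gamma (a + b) / (Real.Gamma a * Real.Gamma b)) * angleConst n *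
        (r * (c ^ 2 * t ^ 2 - r ^ 2) ^ (((n : ℝ) - 2) / 2) /
          ((2 : ℝ) ^ ((n : ℝ) - 2) * c ^ (2 * (n : ℝ) - 2)))) *
      (s ^ (a - n) * (t - s) ^ (b - n) *
        (4 * c ^ 2 * s * (t - s) - c ^ 2 * t ^ 2 + r ^ 2) ^ (((n : ℝ) - 2) / 2)) := by
  have h2 : 0 < t - s := sub_pos.2 h1
  have e1 : s ^ (a - n) = s ^ (a - 1) * s ^ (1 - (n : ℝ)) := by
    rw [← Real.rpow_add h0]; congr 1; ring
  have e2 : (t - s) ^ (b - n) = (t - s) ^ (b - 1) * (t - s) ^ (1 - (n : ℝ)) := by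
    rw [← Real.rpow_add h2]; congr 1; ring
  rw [betaDensity, distKernel, e1, e2, Real.mul_rpow h0.le h2.le]
  ring

variable {Ω : Type*} [MeasurableSpace Ω] {P : Measure Ω} [IsProbabilityMeasure P] {n : ℕ} [NeZero n]
  {a b c t : ℝ} {V : Fin 2 → Ω → UnitSphere (n + 1)} {τ : Ω → Fin 1 → ℝ}

theorem lintegral_norm_map_position (hc : 0 < c)
    (h : IsWalkData P (fun _ => a) (fun _ => b) t V τ) {G : ℝ → ENNReal} (hG : Measurable G) :
    ∫⁻ x, G ‖x‖ ∂(P.map fun ω => position c t (fun k => V k ω) (τ ω)) =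
      ∫⁻ r in Set.Ioo 0 (c * t), normDensity n a b c t r * G r := by
  have hj := measurable_jointDensity n a b c t
  rw [lintegral_map_position h (f := fun x => G ‖x‖) (by fun_prop)]
  calc _ = ∫⁻ s in Set.Ioo 0 t, ∫⁻ r in Set.Ioo 0 (c * t), jointDensity n a b c t (s, r) * G r := by
        refine setLIntegral_congr_fun measurableSet_Ioo fun s hs => ?_
        have hw : ∀ w : UnitSphere (n + 1), ∫⁻ v, G ‖c • (s • (v : EuclideanSpace ℝ (Fin (n + 1))) +
            (t - s) • (w : EuclideanSpace ℝ (Fin (n + 1))))‖ ∂uniformSphere (n + 1) = _ :=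
          fun w => lintegral_norm_two_steps n hc hs.1 hs.2 (e := w) (by simp) hG
        have hI : Set.Ioo (c * |2 * s - t|) (c * t) =
            Set.Ioi (c * |2 * s - t|) ∩ Set.Ioo 0 (c * t) := by
          ext r
          simp only [Set.mem_Ioo, Set.mem_inter_iff, Set.mem_Ioi]
          have : 0 ≤ c * |2 * s - t| := by positivity
          exact ⟨fun h => ⟨h.1, this.trans_lt h.1, h.2⟩, fun h => ⟨h.1, h.2.2⟩⟩
        rw [lintegral_congr hw, lintegral_const, measure_univ, mul_one, hI,
          ← Measure.restrict_restrict measurableSet_Ioi, ← lintegral_indicator measurableSet_Ioi,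
          ← lintegral_const_mul' _ _ ENNReal.ofReal_ne_top,
          ← lintegral_const_mul' _ _ ENNReal.ofReal_ne_top]
        refine lintegral_congr fun r => ?_
        by_cases hr : c * |2 * s - t| < r
        · simp [jointDensity, Set.indicator, hr, angleConst, mul_assoc]
        · simp [jointDensity, Set.indicator, hr]
    _ = ∫⁻ r in Set.Ioo 0 (c * t), ∫⁻ s in Set.Ioo 0 t, jointDensity n a b c t (s, r) * G r := by
        refine lintegral_lintegral_swap (Measurable.aemeasurable ?_)
        exact hj.mul (by fun_prop)
    _ = _ := by
        refine lintegral_congr fun r => ?_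
        exact lintegral_mul_const _ (hj.comp measurable_prodMk_right)

theorem map_position_eq (hc : 0 < c) (h : IsWalkData P (fun _ => a) (fun _ => b) t V τ) :
    P.map (fun ω => position c t (fun k => V k ω) (τ ω)) =
      (volume.restrict (Metric.ball (0 : EuclideanSpace ℝ (Fin (n + 1))) (c * t))).withDensity
        fun x => radialDensity n a b c t ‖x‖ := by
  have hD := measurable_radialDensity n a b c t
  have hA0 := Measure.toSphere_ne_zero (volume : Measure (EuclideanSpace ℝ (Fin (n + 1))))
  rw [← Measure.measure_univ_ne_zero] at hA0
  have hμ : IsFiniteMeasure (P.map fun ω => position c t (fun k => V k ω) (τ ω)) := inferInstance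
  set μ := P.map (fun ω => position c t (fun k => V k ω) (τ ω)) with hμd
  set ν := (volume.restrict (Metric.ball (0 : EuclideanSpace ℝ (Fin (n + 1))) (c * t))).withDensity
        fun x => radialDensity n a b c t ‖x‖ with hν
  have hn : μ.map norm = ν.map norm := by
    refine Measure.ext_of_lintegral _ fun G hG => ?_
    rw [lintegral_map hG measurable_norm, lintegral_map hG measurable_norm,
      lintegral_norm_map_position hc h hG, lintegral_norm_withDensity_norm hD hG,
      ← lintegral_const_mul' _ _ (by finiteness)]
    refine setLIntegral_congr_fun measurableSet_Ioo fun r hr => ?_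
    have hrn : ENNReal.ofReal (r ^ n) ≠ 0 := by
      simpa using pow_pos hr.1 n
    simp only [finrank_euclideanSpace, Fintype.card_fin, add_tsub_cancel_right, radialDensity]
    rw [mul_left_comm (ENNReal.ofReal (r ^ n)), ENNReal.mul_inv_cancel_left hrn (by finiteness),
      mul_assoc, ENNReal.mul_inv_cancel_left hA0 (by finiteness)]
  -- The candidate has the total mass of the law of `X`, because their norms have the same law.
  have hfin : IsFiniteMeasure ν := by
    refine ⟨?_⟩
    have := congrArg (fun m => m Set.univ) hn
    simp only [Measure.map_apply measurable_norm MeasurableSet.univ, Set.preimage_univ] at this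
    rw [← this]
    exact measure_lt_top _ _
  have hσ : IsProbabilityMeasure ((uniformSphere (n + 1)).map Subtype.val) :=
    Measure.isProbabilityMeasure_map measurable_subtype_coe.aemeasurable
  refine ext_of_map_norm_eq (σ := (uniformSphere (n + 1)).map Subtype.val)
    (map_isometry_map_position h) (map_isometry_withDensity_norm hD _) ?_ ?_ hn
  · intro R
    have hR : Measurable R := R.continuous.measurable
    refine Measure.ext_of_lintegral _ fun g hg => ?_
    rw [lintegral_map hg hR, lintegral_map (by fun_prop) measurable_subtype_coe,
      lintegral_map hg measurable_subtype_coe, lintegral_uniformSphere_comp_isometry R hg]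
  · rw [ae_map_iff measurable_subtype_coe.aemeasurable
      (measurableSet_eq_fun measurable_norm measurable_const)]
    exact .of_forall fun v => by simp

/-- Integrability enters only here, to turn the extended nonnegative integral into a real one; `n ≥
1` makes the exponent `(n - 2) / 2` exceed `-1`. -/
theorem normDensity_eq (ha : 0 < a) (hb : 0 < b) (hc : 0 < c) (ht : 0 < t) {r : ℝ} (hr : 0 < r)
    (hrt : r < c * t) :
    normDensity n a b c t r = ENNReal.ofReal
      ((1 / t ^ (a + b - 1) * (Real.Gamma (a + b) / (Real.Gamma a * Real.Gamma b)) * angleConst n *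
        (r * (c ^ 2 * t ^ 2 - r ^ 2) ^ (((n : ℝ) - 2) / 2) /
          ((2 : ℝ) ^ ((n : ℝ) - 2) * c ^ (2 * (n : ℝ) - 2)))) *
      ∫ s in (t / 2 - r / (2 * c))..(t / 2 + r / (2 * c)), s ^ (a - n) * (t - s) ^ (b - n) *
        (4 * c ^ 2 * s * (t - s) - c ^ 2 * t ^ 2 + r ^ 2) ^ (((n : ℝ) - 2) / 2)) := by
  have hn : (1 : ℝ) ≤ n := by exact_mod_cast Nat.pos_of_neZero n
  have hGn : 0 < Real.Gamma ((n : ℝ) / 2) := Real.Gamma_pos_of_pos (by linarith)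
  have hGn1 : 0 < Real.Gamma (((n : ℝ) + 1) / 2) := Real.Gamma_pos_of_pos (by linarith)
  have hK : 0 ≤ angleConst n := by unfold angleConst; positivity
  have hGa := Real.Gamma_pos_of_pos ha
  have hGb := Real.Gamma_pos_of_pos hb
  have hGab := Real.Gamma_pos_of_pos (add_pos ha hb)
  have hbase : 0 ≤ c ^ 2 * t ^ 2 - r ^ 2 := by nlinarith
  have hrc : r / (2 * c) < t / 2 := by
    rw [div_lt_div_iff₀ (by positivity) two_pos]; linarith
  have hrc0 : 0 < r / (2 * c) := by positivity
  have hint := intervalIntegrable_density (α := a - n) (β := b - n) (p := ((n : ℝ) - 2) / 2)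
    hc hr.le hrt (by linarith)
  have hset : {s | c * |2 * s - t| < r} ∩ Set.Ioo 0 t =
      Set.Ioo (t / 2 - r / (2 * c)) (t / 2 + r / (2 * c)) := by
    ext s
    have : c * |2 * s - t| < r ↔ |2 * s - t| < 2 * (r / (2 * c)) := by
      rw [mul_comm, ← lt_div_iff₀ hc]
      have : 2 * (r / (2 * c)) = r / c := by field_simp
      rw [this]
    simp only [Set.mem_inter_iff, Set.mem_ofPred_eq, this, abs_lt, Set.mem_Ioo]
    constructor
    · rintro ⟨⟨h1, h2⟩, -, -⟩; constructor <;> linarith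
    · rintro ⟨h1, h2⟩; refine ⟨⟨?_, ?_⟩, ?_, ?_⟩ <;> linarith
  have hms : MeasurableSet {s | c * |2 * s - t| < r} :=
    measurableSet_lt (by fun_prop) (by fun_prop)
  set Q := (1 / t ^ (a + b - 1) * (Real.Gamma (a + b) / (Real.Gamma a * Real.Gamma b)) *
    angleConst n * (r * (c ^ 2 * t ^ 2 - r ^ 2) ^ (((n : ℝ) - 2) / 2) /
          ((2 : ℝ) ^ ((n : ℝ) - 2) * c ^ (2 * (n : ℝ) - 2)))) with hQ
  have hQ0 : 0 ≤ Q := by positivity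
  rw [intervalIntegral.integral_of_le (by linarith), ← integral_const_mul,
    ofReal_integral_eq_lintegral_ofReal
      (((intervalIntegrable_iff_integrableOn_Ioc_of_le (by linarith)).1 hint).const_mul Q),
    Measure.restrict_congr_set Ioo_ae_eq_Ioc.symm, ← hset, ← Measure.restrict_restrict hms,
    ← lintegral_indicator hms, normDensity]
  · refine setLIntegral_congr_fun measurableSet_Ioo fun s hs => ?_
    by_cases h : c * |2 * s - t| < r
    · have hβ : 0 ≤ betaDensity a b t s := by
        have := hs.1
        have := sub_pos.2 hs.2
        unfold betaDensity
        positivity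
      simp only [jointDensity, Set.indicator, Set.mem_ofPred_eq, h, if_true]
      rw [← ENNReal.ofReal_mul hK, ← ENNReal.ofReal_mul hβ, betaDensity_mul_distKernel hs.1 hs.2]
    · simp [jointDensity, Set.indicator, h]
  · filter_upwards [ae_restrict_mem measurableSet_Ioc] with s hs
    have h1 : 0 ≤ s := by linarith [hs.1]
    have h2 : 0 ≤ t - s := by linarith [hs.2]
    have h3 : 0 ≤ 4 * c ^ 2 * s * (t - s) - c ^ 2 * t ^ 2 + r ^ 2 := by
      have : 4 * c ^ 2 * s * (t - s) - c ^ 2 * t ^ 2 + r ^ 2 =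
          4 * c ^ 2 * ((s - (t / 2 - r / (2 * c))) * (t / 2 + r / (2 * c) - s)) := by
        field_simp
        ring
      rw [this]
      exact mul_nonneg (by positivity) (mul_nonneg (by linarith [hs.1]) (by linarith [hs.2]))
    positivity

theorem radialDensity_eq (ha : 0 < a) (hb : 0 < b) (hc : 0 < c) (ht : 0 < t) {r : ℝ} (hr : 0 < r)
    (hrt : r < c * t) {d : ℝ} (hd : d = n + 1) :
    radialDensity n a b c t r = ENNReal.ofReal
      (1 / ((2 : ℝ) ^ (d - 2) * Real.pi ^ ((d + 1) / 2)) *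
        (Real.Gamma (d / 2) ^ 2 / Real.Gamma (d / 2 - 1 / 2)) *
        (Real.Gamma (a + b) / (Real.Gamma a * Real.Gamma b)) *
        (1 / t ^ (a + b - 1)) *
        ((c ^ 2 * t ^ 2 - r ^ 2) ^ ((d - 3) / 2) / (r ^ (d - 2) * c ^ (2 * d - 4))) *
        ∫ s in (t / 2 - r / (2 * c))..(t / 2 + r / (2 * c)),
          s ^ (a - d + 1) * (t - s) ^ (b - d + 1) *
            (4 * c ^ 2 * s * (t - s) - c ^ 2 * t ^ 2 + r ^ 2) ^ ((d - 3) / 2)) := by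
  subst hd
  have hn : (1 : ℝ) ≤ n := by exact_mod_cast Nat.pos_of_neZero n
  have hGn : 0 < Real.Gamma ((n : ℝ) / 2) := Real.Gamma_pos_of_pos (by linarith)
  have hGn1 : 0 < Real.Gamma (((n : ℝ) + 1) / 2) := Real.Gamma_pos_of_pos (by linarith)
  rw [radialDensity, normDensity_eq ha hb hc ht hr hrt, toSphere_univ_eq,
    ← ENNReal.ofReal_inv_of_pos (by push_cast; positivity), ← ENNReal.ofReal_inv_of_pos (by positivity),
    ← ENNReal.ofReal_mul (by positivity), ← ENNReal.ofReal_mul (by push_cast; positivity)]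
  have e1 : ((n : ℝ) + 1 - 3) / 2 = ((n : ℝ) - 2) / 2 := by ring
  have e2 : a - ((n : ℝ) + 1) + 1 = a - n := by ring
  have e3 : b - ((n : ℝ) + 1) + 1 = b - n := by ring
  have e4 : ((n : ℝ) + 1) / 2 - 1 / 2 = n / 2 := by ring
  have e5 : 2 * ((n : ℝ) + 1) - 4 = 2 * n - 2 := by ring
  have e6 : (2 : ℝ) ^ ((n : ℝ) + 1 - 2) = 2 ^ ((n : ℝ) - 2) * 2 := by
    rw [← Real.rpow_add_one two_ne_zero]; congr 1; ring
  have e7 : r ^ ((n : ℝ) + 1 - 2) = r ^ n / r := by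
    rw [← Real.rpow_natCast r n, ← Real.rpow_sub_one hr.ne']; congr 1; ring
  have e8 : Real.pi ^ (((n : ℝ) + 1 + 1) / 2) = Real.pi ^ (((n : ℝ) + 1) / 2) * √Real.pi := by
    rw [Real.sqrt_eq_rpow, ← Real.rpow_add Real.pi_pos]; congr 1; ring
  rw [e1, e2, e3, e4, e5, e6, e7, e8, angleConst]
  congr 1
  push_cast
  -- With the exponents aligned, both sides carry the same integral and only an identity between
  -- constants is left.
  generalize (∫ s in (t / 2 - r / (2 * c))..(t / 2 + r / (2 * c)), _ : ℝ) = I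
  have p1 := Real.rpow_pos_of_pos Real.pi_pos (((n : ℝ) + 1) / 2)
  have p2 := Real.rpow_pos_of_pos (two_pos (α := ℝ)) ((n : ℝ) - 2)
  have p3 := Real.rpow_pos_of_pos hc (2 * (n : ℝ) - 2)
  have p4 := Real.sqrt_pos.2 Real.pi_pos
  have p5 := pow_pos hr n
  generalize Real.pi ^ (((n : ℝ) + 1) / 2) = x1 at *
  generalize (2 : ℝ) ^ ((n : ℝ) - 2) = x2 at *
  generalize c ^ (2 * (n : ℝ) - 2) = x3 at *
  generalize √Real.pi = x4 at *
  generalize r ^ n = x5 at *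
  generalize (c ^ 2 * t ^ 2 - r ^ 2) ^ (((n : ℝ) - 2) / 2) = x6 at *
  generalize Real.Gamma (((n : ℝ) + 1) / 2) = x7 at *
  generalize Real.Gamma ((n : ℝ) / 2) = x8 at *
  generalize (Real.Gamma (a + b) / (Real.Gamma a * Real.Gamma b)) = x9 at *
  generalize 1 / t ^ (a + b - 1) = x10 at *
  field_simp

end Density

end RandomFlight

theorem mainTheorem5 {Ω : Type*} [MeasurableSpace Ω] (P : Measure Ω) [IsProbabilityMeasure P]
    (d : ℕ) (hd : 2 ≤ d) (a₁ b₁ c t : ℝ) (ha : 0 < a₁) (hb : 0 < b₁) (hc : 0 < c) (ht : 0 < t)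
    (V : Fin 2 → Ω → RandomFlight.UnitSphere d) (τ : Ω → Fin 1 → ℝ)
    (hwalk : RandomFlight.IsWalkData P (fun _ => a₁) (fun _ => b₁) t V τ) :
    (∀ x : EuclideanSpace ℝ (Fin d), ‖x‖ < c * t →
      IntervalIntegrable
        (fun τ₁ : ℝ => τ₁ ^ (a₁ - d + 1) * (t - τ₁) ^ (b₁ - d + 1) *
          (4 * c ^ 2 * τ₁ * (t - τ₁) - c ^ 2 * t ^ 2 + ‖x‖ ^ 2) ^ (((d : ℝ) - 3) / 2))
        volume (t / 2 - ‖x‖ / (2 * c)) (t / 2 + ‖x‖ / (2 * c))) ∧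
    HasLaw (fun ω => RandomFlight.position c t (fun k => V k ω) (τ ω))
      ((volume.restrict (Metric.ball (0 : EuclideanSpace ℝ (Fin d)) (c * t))).withDensity
        fun x => ENNReal.ofReal
          (1 / ((2 : ℝ) ^ ((d : ℝ) - 2) * Real.pi ^ (((d : ℝ) + 1) / 2)) *
            (Real.Gamma ((d : ℝ) / 2) ^ 2 / Real.Gamma ((d : ℝ) / 2 - 1 / 2)) *
            (Real.Gamma (a₁ + b₁) / (Real.Gamma a₁ * Real.Gamma b₁)) *
            (1 / t ^ (a₁ + b₁ - 1)) *
            ((c ^ 2 * t ^ 2 - ‖x‖ ^ 2) ^ (((d : ℝ) - 3) / 2) /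
              (‖x‖ ^ ((d : ℝ) - 2) * c ^ (2 * (d : ℝ) - 4))) *
            ∫ τ₁ in (t / 2 - ‖x‖ / (2 * c))..(t / 2 + ‖x‖ / (2 * c)),
              τ₁ ^ (a₁ - d + 1) * (t - τ₁) ^ (b₁ - d + 1) *
                (4 * c ^ 2 * τ₁ * (t - τ₁) - c ^ 2 * t ^ 2 + ‖x‖ ^ 2) ^ (((d : ℝ) - 3) / 2)))
      P := by
  obtain ⟨n, rfl⟩ : ∃ n, d = n + 1 := ⟨d - 1, by omega⟩
  have hn : NeZero n := ⟨by omega⟩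
  have hn1 : (1 : ℝ) ≤ n := by exact_mod_cast Nat.pos_of_neZero n
  refine ⟨fun x hx => ?_, RandomFlight.aemeasurable_position hwalk, ?_⟩
  · have := RandomFlight.intervalIntegrable_density (α := a₁ - (n + 1 : ℕ) + 1)
      (β := b₁ - (n + 1 : ℕ) + 1) (p := (((n + 1 : ℕ) : ℝ) - 3) / 2) hc (norm_nonneg x) hx
      (by push_cast; linarith)
    exact this
  · rw [RandomFlight.map_position_eq hc hwalk]
    refine withDensity_congr_ae ?_
    -- The explicit formula is available only for `‖x‖ > 0`; the origin is a null set.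
    have h0 : ∀ᵐ x ∂(volume : Measure (EuclideanSpace ℝ (Fin (n + 1)))), x ≠ 0 :=
      compl_mem_ae_iff.2 (measure_singleton 0)
    filter_upwards [ae_restrict_mem measurableSet_ball, ae_restrict_of_ae h0] with x hx hx0
    exact RandomFlight.radialDensity_eq ha hb hc ht (norm_pos_iff.2 hx0)
      (mem_ball_zero_iff.1 hx) (by push_cast; rfl)
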